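/- Let $s\in\mathbb{C}$ with $\Re s>1$. For $J\ge 1$ put $\theta_j=\frac{2j+1}{2J}\pi$ $(0\le j<J)$ and \[ \xi_s(J)=\sum_{m=0}^\infty(-1)^m\sum_{j=0}^{J-1}\frac{1}{(2Jm+2j+1)^s}. \] Let $B_s$ be the continuation to complex order of the periodic Bernoulli polynomials of odd degree, \[ B_s(x)=-\frac{\Gamma(s+1)}{(2\pi i)^s}\sum_{k\in\mathbb{Z}\setminus\{0\}}\frac{\operatorname{sgn}(k)\,e^{2\pi i kx}}{|k|^s}\qquad(x\in\mathbb{R}), \] with the principal branch of $(2\pi i)^s$; equivalently $\frac{i}{2}\frac{(2\pi i)^s}{\Gamma(s+1)}B_s(x)=\sum_{k\ge1}\frac{\sin(2\pi kx)}{k^s}$, and for odd integers $s\ge3$ the function $B_s$ is on $[0,1]$ the Bernoulli polynomial of degree $s$. Then the series defining $\xi_s(J)$ converges absolutely, and as $J\to\infty$ \[ \xi_s(J)\longrightarrow\sum_{m=0}^\infty\frac{1}{(2m+1)^s}=(1-2^{-s})\zeta(s). \] Moreover the principal value \[ \mathrm{p.v.}\!\int_0^1\frac{B_s(x)}{\sin(2\pi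 x)}\,dx=\lim_{\varepsilon\to0^+}\left(\int_{\varepsilon}^{1/2-\varepsilon}+\int_{1/2+\varepsilon}^{1-\varepsilon}\right)\frac{B_s(x)}{\sin(2\pi x)}\,dx \] exists, \[ \frac1J\sum_{j=0}^{J-1}\frac{B_s\!\left(\frac{2j+1}{4J}\right)}{\sin\theta_j}\longrightarrow\mathrm{p.v.}\!\int_0^1\frac{B_s(x)}{\sin(2\pi x)}\,dx\qquad(J\to\infty), \] and \[ (1-2^{-s})\zeta(s)=\frac{i}{2}\,\frac{(2\pi i)^s}{\Gamma(s+1)}\;\mathrm{p.v.}\!\int_0^1\frac{B_s(x)}{\sin(2\pi x)}\,dx . \] -/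

import Mathlib

open Complex Filter Topology MeasureTheory

noncomputable section

/-- The nodes `θ_j = (2j+1)π / (2J)`. -/
def thetaNode (J j : ℕ) : ℝ := (2 * j + 1) / (2 * J) * Real.pi

/-- The block `∑_{j<J} 1 / (2Jm+2j+1)^s`. -/
def xiBlock (s : ℂ) (J m : ℕ) : ℂ :=
  ∑ j ∈ Finset.range J, 1 / ((2 * J * m + 2 * j + 1 : ℕ) : ℂ) ^ s

/-- `ξ_s(J) = ∑_{m≥0} (-1)^m ∑_{j<J} 1 / (2Jm+2j+1)^s`. -/
def xi (s : ℂ) (J : ℕ) : ℂ := ∑' m : ℕ, (-1 : ℂ) ^ m * xiBlock s J m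

/-- The function `B_s(x)`: the continuation to complex order `s`, `Re s > 1`, of the periodic
Bernoulli polynomials of odd degree, obtained from their Fourier series
`-n!/(2πi)^n ∑_{k≠0} e^{2πikx} / k^n` by reading `k^n` as `sgn(k) |k|^s` and `n!` as `Γ(s+1)`
(the term `k = 0` vanishes because `sgn 0 = 0`). Equivalently
`(i/2) (2πi)^s / Γ(s+1) * B_s(x) = ∑_{k≥1} sin(2πkx) / k^s`. -/
def bernoulliFn (s : ℂ) (x : ℝ) : ℂ :=
  -(Gamma (s + 1) / (2 * Real.pi * I) ^ s) *
    ∑' k : ℤ, (k.sign : ℂ) / (k.natAbs : ℂ) ^ s * exp (2 * Real.pi * I * k * x)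

/-- At the odd integers `n ≥ 3`, `B_n` is on `[0,1]` the Bernoulli polynomial of degree `n`. -/
theorem bernoulliFn_odd (n : ℕ) (hn : 1 ≤ n) (x : ℝ) (hx : x ∈ Set.Icc (0 : ℝ) 1) :
    bernoulliFn ((2 * n + 1 : ℕ) : ℂ) x = (bernoulliFun (2 * n + 1) x : ℂ) := by
  have h := hasSum_one_div_pow_mul_fourier_mul_bernoulliFun (k := 2 * n + 1) (by omega) hx
  have e : ∀ k : ℤ, (k.sign : ℂ) / (k.natAbs : ℂ) ^ ((2 * n + 1 : ℕ) : ℂ) *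
      exp (2 * Real.pi * I * k * x) =
      1 / (k : ℂ) ^ (2 * n + 1) * fourier k (x : UnitAddCircle) := by
    intro k
    rw [fourier_coe_apply, cpow_natCast]
    congr 1
    · have hk : (k : ℂ) = (k.sign : ℂ) * (k.natAbs : ℂ) := by
        have h3 := congrArg (Int.cast : ℤ → ℂ) (Int.sign_mul_natAbs k)
        rw [Int.cast_mul, Int.cast_natCast] at h3
        exact h3.symm
      rcases lt_trichotomy k 0 with h0 | h0 | h0
      · rw [Int.sign_eq_neg_one_of_neg h0] at hk ⊢
        rw [hk, mul_pow]
        have : (((-1 : ℤ) : ℂ)) ^ (2 * n + 1) = -1 := by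
          push_cast; exact Odd.neg_one_pow ⟨n, rfl⟩
        rw [this]; push_cast
        rw [neg_one_mul, div_neg, neg_div]
      · subst h0; simp
      · rw [Int.sign_eq_one_of_pos h0] at hk ⊢
        rw [hk]; simp
    · simp
  unfold bernoulliFn
  rw [tsum_congr e, h.tsum_eq, cpow_natCast, Gamma_nat_eq_factorial]
  have h1 : ((2 * n + 1).factorial : ℂ) ≠ 0 := by exact_mod_cast Nat.factorial_ne_zero _
  have h2 : (2 * (Real.pi : ℂ) * I) ^ (2 * n + 1) ≠ 0 := pow_ne_zero _ two_pi_I_ne_zero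
  field_simp

/-- The kernel average `(1/J) ∑_{j<J} B_s((2j+1)/(4J)) / sin θ_j`. -/
def kernelAverage (s : ℂ) (J : ℕ) : ℂ :=
  1 / (J : ℂ) * ∑ j ∈ Finset.range J,
    bernoulliFn s ((2 * j + 1) / (4 * J)) / (Real.sin (thetaNode J j) : ℂ)

/-- The interval `(a,b)` with the closed `ε`-neighbourhoods of the points of `S` removed. -/
def cutInterval (a b : ℝ) (S : Set ℝ) (ε : ℝ) : Set ℝ :=
  {x | x ∈ Set.Ioo a b ∧ ∀ p ∈ S, ε < |x - p|}

/-- `P` is the Cauchy principal value of `∫_a^b f`, with singular points `S`: `f` is integrable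
off each `ε`-neighbourhood of `S`, and the truncated integrals tend to `P` as `ε → 0+`. -/
def HasPrincipalValue (f : ℝ → ℂ) (a b : ℝ) (S : Set ℝ) (P : ℂ) : Prop :=
  (∀ ε > 0, IntegrableOn f (cutInterval a b S ε)) ∧
    Tendsto (fun ε : ℝ => ∫ x in cutInterval a b S ε, f x) (𝓝[>] 0) (𝓝 P)

end

/-! ### The Dirichlet series over the odd numbers -/

/-! Up to the nonzero constant `c = I / 2 * ((2πI)^s / Γ(s+1))`, `B_s` is a sine series, so dividing
by `sin θ` leaves the kernels `sin kθ / sin θ` with weights `k^(-s)`. By a step-two recurrence in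
`k`, their averages over the nodes are `0` for even `k` and `(-1)^(n/J)` for `k = 2n+1`
(`sum_kernel_even`, `sum_kernel_odd`), while their integrals over a period are `0` and `1`
(`integral_kernel_even`, `integral_kernel_odd`). Hence `kernelAverage s J = c⁻¹ * xi s J`, and the
integral is `c⁻¹` times the odd Dirichlet series, which is also the limit of `c⁻¹ * xi s J` by
dominated convergence.

Integrating termwise needs care when `Re s ≤ 2`: the bound `|sin kθ / sin θ| ≤ k` is then too weak
to sum. The interpolated bound `k^a |sin θ|^(a-1)` with small `a > 0` is both summable against
`k^(-Re s)` and integrable. So the integral converges absolutely, and the principal value is just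
this integral. -/

theorem norm_one_div_natCast_cpow {s : ℂ} (hs : s.re ≠ 0) (n : ℕ) :
    ‖1 / (n : ℂ) ^ s‖ = 1 / (n : ℝ) ^ s.re := by
  rw [norm_div, norm_one, norm_natCast_cpow_of_re_ne_zero n hs]

theorem summable_one_div_odd_rpow {r : ℝ} (hr : 1 < r) :
    Summable fun m : ℕ => 1 / ((2 * m + 1 : ℕ) : ℝ) ^ r :=
  (Real.summable_one_div_nat_rpow.mpr hr).comp_injective
    (i := fun m : ℕ => 2 * m + 1) (fun a b h => by simpa using h)

theorem hasSum_one_div_odd_cpow {s : ℂ} (hs : 1 < s.re) :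
    HasSum (fun m : ℕ => 1 / ((2 * m + 1 : ℕ) : ℂ) ^ s) ((1 - 2 ^ (-s)) * riemannZeta s) := by
  have hsum : Summable fun n : ℕ => 1 / (n : ℂ) ^ s := summable_one_div_nat_cpow.mpr hs
  have hodd : Summable fun m : ℕ => 1 / ((2 * m + 1 : ℕ) : ℂ) ^ s :=
    hsum.comp_injective (i := fun m : ℕ => 2 * m + 1) (fun a b h => by simpa using h)
  have hzeta : HasSum (fun n : ℕ => 1 / (n : ℂ) ^ s) (riemannZeta s) := by
    rw [zeta_eq_tsum_one_div_nat_cpow hs]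
    exact hsum.hasSum
  -- The even terms carry the share `2^(-s)` of zeta; removing them leaves the odd ones.
  have heven : HasSum (fun m : ℕ => 1 / ((2 * m : ℕ) : ℂ) ^ s) (2 ^ (-s) * riemannZeta s) := by
    refine (hzeta.mul_left ((2 : ℂ) ^ (-s))).congr_fun fun m => ?_
    have h := natCast_mul_natCast_cpow 2 m s
    push_cast at h ⊢
    rw [h, cpow_neg, one_div, one_div, mul_inv]
  have h := (heven.even_add_odd (f := fun n : ℕ => 1 / (n : ℂ) ^ s) hodd.hasSum).unique hzeta
  convert hodd.hasSum using 1
  linear_combination -h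

/-! ### The block sums -/

/-- Regrouping of the signed odd series into blocks of length `J`. -/
theorem signed_odd_blocks {s : ℂ} (hs : 1 < s.re) (J : ℕ) (hJ : J ≠ 0) :
    (Summable fun m : ℕ => (-1 : ℂ) ^ m * xiBlock s J m) ∧
      xi s J = ∑' n : ℕ, (-1 : ℂ) ^ (n / J) * (1 / ((2 * n + 1 : ℕ) : ℂ) ^ s) := by
  have : NeZero J := ⟨hJ⟩
  set g : ℕ → ℂ := fun n => (-1 : ℂ) ^ (n / J) * (1 / ((2 * n + 1 : ℕ) : ℂ) ^ s) with hg
  have hgs : Summable g := by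
    refine Summable.of_norm_bounded (summable_one_div_odd_rpow hs) fun n => ?_
    rw [hg, norm_mul, norm_one_div_natCast_cpow (by linarith)]
    simp
  have hprod : Summable fun p : ℕ × Fin J => g ((Nat.divModEquiv J).symm p) :=
    (Nat.divModEquiv J).symm.summable_iff.mpr hgs
  have hblock : ∀ m : ℕ, ∑' j : Fin J, g ((Nat.divModEquiv J).symm (m, j)) =
      (-1 : ℂ) ^ m * xiBlock s J m := by
    intro m
    rw [tsum_fintype, xiBlock, Finset.mul_sum, ← Fin.sum_univ_eq_sum_range
      (fun j => (-1 : ℂ) ^ m * (1 / ((2 * J * m + 2 * j + 1 : ℕ) : ℂ) ^ s)) J]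
    refine Finset.sum_congr rfl fun j _ => ?_
    have hdiv : (m * J + (j : ℕ)) / J = m := by
      rw [Nat.add_comm, Nat.add_mul_div_right _ _ (Nat.pos_of_ne_zero hJ),
        Nat.div_eq_of_lt j.is_lt, Nat.zero_add]
    have hidx : 2 * (m * J + (j : ℕ)) + 1 = 2 * J * m + 2 * j + 1 := by ring
    simp only [hg, Nat.divModEquiv_symm_apply, hdiv, hidx]
  refine ⟨hprod.prod.congr hblock, ?_⟩
  rw [← (Nat.divModEquiv J).symm.tsum_eq g, hprod.tsum_prod, xi]
  exact tsum_congr fun m => (hblock m).symm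

theorem summable_xiBlock {s : ℂ} (hs : 1 < s.re) (J : ℕ) :
    Summable fun m : ℕ => (-1 : ℂ) ^ m * xiBlock s J m := by
  rcases eq_or_ne J 0 with rfl | hJ
  · simp [xiBlock, summable_zero]
  · exact (signed_odd_blocks hs J hJ).1

/-- For fixed `n` the sign `(-1)^(n/J)` is `1` as soon as `J > n`, and the absolute series dominates
uniformly in `J`. -/
theorem tendsto_xi {s : ℂ} (hs : 1 < s.re) :
    Tendsto (fun J : ℕ => xi s J) atTop (𝓝 (∑' m : ℕ, 1 / ((2 * m + 1 : ℕ) : ℂ) ^ s)) := by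
  have h : Tendsto (fun J : ℕ => ∑' n : ℕ, (-1 : ℂ) ^ (n / J) * (1 / ((2 * n + 1 : ℕ) : ℂ) ^ s))
      atTop (𝓝 (∑' m : ℕ, 1 / ((2 * m + 1 : ℕ) : ℂ) ^ s)) := by
    refine tendsto_tsum_of_dominated_convergence (summable_one_div_odd_rpow hs) (fun n => ?_)
      (Eventually.of_forall fun J n => ?_)
    · refine tendsto_const_nhds.congr' ?_
      filter_upwards [eventually_gt_atTop n] with J hJ
      rw [Nat.div_eq_of_lt hJ, pow_zero, one_mul]
    · rw [norm_mul, norm_one_div_natCast_cpow (by linarith)]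
      simp
  refine h.congr' ?_
  filter_upwards [eventually_ne_atTop 0] with J hJ
  exact (signed_odd_blocks hs J hJ).2.symm

/-! ### The sine series -/

/-- The sine series `∑ sin(2πkx) / k^s`. -/
noncomputable def sineSeries (s : ℂ) (x : ℝ) : ℂ :=
  ∑' k : ℕ, 1 / (k : ℂ) ^ s * (Real.sin (k * (2 * Real.pi * x)) : ℂ)

theorem summable_sineSeries {s : ℂ} (hs : 1 < s.re) (x : ℝ) :
    Summable fun k : ℕ => 1 / (k : ℂ) ^ s * (Real.sin (k * (2 * Real.pi * x)) : ℂ) := by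
  refine Summable.of_norm_bounded (Real.summable_one_div_nat_rpow.mpr hs) fun k => ?_
  rw [norm_mul, norm_one_div_natCast_cpow (by linarith), norm_real, Real.norm_eq_abs]
  exact mul_le_of_le_one_right (by positivity) (Real.abs_sin_le_one _)

theorem continuous_sineSeries {s : ℂ} (hs : 1 < s.re) : Continuous (sineSeries s) := by
  refine continuous_tsum (fun k => by fun_prop) (Real.summable_one_div_nat_rpow.mpr hs)
    fun k x => ?_
  rw [norm_mul, norm_one_div_natCast_cpow (by linarith), norm_real, Real.norm_eq_abs]
  exact mul_le_of_le_one_right (by positivity) (Real.abs_sin_le_one _)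

theorem bernoulliFn_eq_sineSeries {s : ℂ} (hs : 1 < s.re) (x : ℝ) :
    bernoulliFn s x = (I / 2 * ((2 * Real.pi * I) ^ s / Gamma (s + 1)))⁻¹ * sineSeries s x := by
  set t : ℤ → ℂ := fun k => (k.sign : ℂ) / (k.natAbs : ℂ) ^ s * exp (2 * Real.pi * I * k * x)
    with ht
  have hexp : ∀ k : ℤ, exp (2 * Real.pi * I * k * x) =
      exp ((k * (2 * Real.pi * x) : ℝ) * I) := fun k => by
    congr 1
    push_cast
    ring
  have hpos : ∀ n : ℕ, 0 < n →
      t n = 1 / (n : ℂ) ^ s * exp ((n * (2 * Real.pi * x) : ℝ) * I) := by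
    intro n h0
    have h := hexp n
    rw [Int.cast_natCast, Int.cast_natCast] at h
    simp only [ht, Int.sign_eq_one_of_pos (Int.natCast_pos.mpr h0), Int.natAbs_natCast,
      Int.cast_one, Int.cast_natCast, h]
  have hneg : ∀ n : ℕ, 0 < n →
      t (-n) = -(1 / (n : ℂ) ^ s * exp (-(n * (2 * Real.pi * x) : ℝ) * I)) := by
    intro n h0
    simp only [ht, hexp, Int.sign_neg, Int.sign_eq_one_of_pos (Int.natCast_pos.mpr h0),
      Int.natAbs_neg, Int.natAbs_natCast]
    push_cast
    rw [neg_div, neg_mul, neg_mul]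
  have ht0 : t 0 = 0 := by simp [ht]
  have hbound : ∀ k : ℤ, ‖t k‖ ≤ 1 / (k.natAbs : ℝ) ^ s.re := by
    intro k
    simp only [ht, hexp]
    rw [norm_mul, norm_exp_ofReal_mul_I, mul_one, norm_div,
      norm_natCast_cpow_of_re_ne_zero _ (by linarith)]
    gcongr
    rcases lt_trichotomy k 0 with h | h | h
    · simp [Int.sign_eq_neg_one_of_neg h]
    · simp [h]
    · simp [Int.sign_eq_one_of_pos h]
  have hs1 : Summable fun n : ℕ => t n :=
    Summable.of_norm_bounded (Real.summable_one_div_nat_rpow.mpr hs) fun n => by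
      simpa using hbound n
  have hs2 : Summable fun n : ℕ => t (-n) :=
    Summable.of_norm_bounded (Real.summable_one_div_nat_rpow.mpr hs) fun n => by
      simpa using hbound (-n)
  have hsum : ∑' k : ℤ, t k = 2 * I * sineSeries s x := by
    -- Pairing `k` with `-k` counts `k = 0` twice, harmlessly since `t 0 = 0`; the opposite signs
    -- turn each pair of exponentials into a sine.
    rw [(hs1.hasSum.of_nat_of_neg hs2.hasSum).tsum_eq, ht0, sub_zero,
      ← hs1.tsum_add hs2, sineSeries, ← tsum_mul_left]
    refine tsum_congr fun n => ?_
    rcases Nat.eq_zero_or_pos n with h0 | h0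
    · simp [h0, ht0]
    · rw [hpos n h0, hneg n h0, ofReal_sin, Complex.sin]
      linear_combination -(1 / (n : ℂ) ^ s * (exp (-(n * (2 * Real.pi * x) : ℝ) * I)
        - exp ((n * (2 * Real.pi * x) : ℝ) * I))) * I_sq
  have hG : Gamma (s + 1) ≠ 0 := Gamma_ne_zero_of_re_pos (by simp; linarith)
  have hc : (2 * Real.pi * I : ℂ) ^ s ≠ 0 := by
    rw [Ne, cpow_eq_zero_iff]
    exact fun h => two_pi_I_ne_zero h.1
  unfold bernoulliFn
  rw [hsum]
  have hI : I ≠ 0 := I_ne_zero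
  field_simp
  linear_combination (-sineSeries s x) * I_sq

/-! ### The kernel `sin(kθ) / sin θ` -/

theorem sin_add_two_mul (k : ℕ) (θ : ℝ) : Real.sin ((k + 2 : ℕ) * θ) =
    Real.sin (k * θ) + 2 * Real.cos ((k + 1 : ℕ) * θ) * Real.sin θ := by
  have h1 : ((k + 2 : ℕ) : ℝ) * θ = (k + 1 : ℕ) * θ + θ := by push_cast; ring
  have h2 : (k : ℝ) * θ = (k + 1 : ℕ) * θ - θ := by push_cast; ring
  rw [h1, h2, Real.sin_add, Real.sin_sub]
  ring

/-- This recurrence reduces the discrete and the continuous averages of the kernel to averages of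
cosines. -/
theorem sin_div_sin_add_two (k : ℕ) {θ : ℝ} (h : Real.sin θ ≠ 0) :
    Real.sin ((k + 2 : ℕ) * θ) / Real.sin θ =
      Real.sin (k * θ) / Real.sin θ + 2 * Real.cos ((k + 1 : ℕ) * θ) := by
  rw [sin_add_two_mul]
  field_simp

theorem abs_sin_nat_mul_le (k : ℕ) (θ : ℝ) : |Real.sin (k * θ)| ≤ k * |Real.sin θ| := by
  induction k with
  | zero => simp
  | succ k ih =>
    have h1 : ((k + 1 : ℕ) : ℝ) * θ = k * θ + θ := by push_cast; ring
    rw [h1, Real.sin_add]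
    refine (abs_add_le _ _).trans ?_
    rw [abs_mul, abs_mul]
    have h2 := mul_le_of_le_one_right (abs_nonneg (Real.sin (k * θ))) (Real.abs_cos_le_one θ)
    have h3 := mul_le_of_le_one_left (abs_nonneg (Real.sin θ)) (Real.abs_cos_le_one (k * θ))
    push_cast
    linarith

/-- Interpolation between `|sin kθ| ≤ k |sin θ|` and `|sin kθ| ≤ 1`. -/
theorem abs_sin_div_sin_le (k : ℕ) (θ : ℝ) {a : ℝ} (ha : 0 < a) (ha1 : a < 1) :
    |Real.sin (k * θ) / Real.sin θ| ≤ (k : ℝ) ^ a * |Real.sin θ| ^ (a - 1) := by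
  rcases eq_or_ne (Real.sin θ) 0 with h0 | h0
  · rw [h0, div_zero, abs_zero]
    positivity
  have hpos : 0 < |Real.sin θ| := abs_pos.mpr h0
  rw [abs_div, div_le_iff₀ hpos, mul_assoc, ← Real.rpow_add_one hpos.ne', sub_add_cancel,
    ← Real.mul_rpow (by positivity) hpos.le]
  have h1 : |Real.sin (k * θ)| ≤ |Real.sin (k * θ)| ^ a := by
    rcases eq_or_lt_of_le (abs_nonneg (Real.sin (k * θ))) with h | h
    · rw [← h, Real.zero_rpow ha.ne']
    · exact Real.self_le_rpow_of_le_one h.le (Real.abs_sin_le_one _) ha1.le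
  exact h1.trans (Real.rpow_le_rpow (abs_nonneg _) (abs_sin_nat_mul_le k θ) ha.le)

/-! ### The discrete average of the kernel -/

theorem sin_thetaNode_pos {J j : ℕ} (hj : j < J) : 0 < Real.sin (thetaNode J j) := by
  have hJ : (0 : ℝ) < J := by exact_mod_cast (Nat.zero_le j).trans_lt hj
  have hlt : (2 * j + 1 : ℝ) < 2 * J := by
    have : 2 * j + 1 < 2 * J := by omega
    exact_mod_cast this
  apply Real.sin_pos_of_pos_of_lt_pi
  · unfold thetaNode
    positivity
  · unfold thetaNode
    exact mul_lt_of_lt_one_left Real.pi_pos ((div_lt_one (by positivity)).mpr hlt)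

/-- The sum telescopes: `2 sin β cos((2j+1)β) = sin((2j+2)β) - sin(2jβ)`. -/
theorem two_sin_mul_sum_cos_odd (β : ℝ) (J : ℕ) :
    2 * Real.sin β * ∑ j ∈ Finset.range J, Real.cos ((2 * j + 1) * β) =
      Real.sin (2 * J * β) := by
  induction J with
  | zero => simp
  | succ J ih =>
    rw [Finset.sum_range_succ, mul_add, ih]
    have h1 : 2 * (J : ℝ) * β = (2 * J + 1) * β - β := by ring
    have h2 : 2 * ((J + 1 : ℕ) : ℝ) * β = (2 * J + 1) * β + β := by push_cast; ring
    rw [h1, h2, Real.sin_sub, Real.sin_add]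
    ring

theorem sum_cos_thetaNode_of_not_dvd {J m : ℕ} (hJ : J ≠ 0) (h : ¬ 2 * J ∣ m) :
    ∑ j ∈ Finset.range J, Real.cos (m * thetaNode J j) = 0 := by
  have hJ' : (J : ℝ) ≠ 0 := by exact_mod_cast hJ
  -- With this `β`, `m θ_j = (2j+1)β`. The telescoped value `sin(2Jβ) = sin(mπ)` vanishes, while
  -- `sin β` does not.
  set β : ℝ := m / (2 * J) * Real.pi with hβ
  have hsin : Real.sin β ≠ 0 := by
    intro h0
    obtain ⟨n, hn⟩ := Real.sin_eq_zero_iff.mp h0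
    have h1 : (n : ℝ) = m / (2 * J) := mul_right_cancel₀ Real.pi_ne_zero hn
    have h2 : (m : ℝ) = 2 * J * n := by rw [h1]; field_simp
    have h3 : (m : ℤ) = ((2 * J : ℕ) : ℤ) * n := by
      have : ((m : ℤ) : ℝ) = ((((2 * J : ℕ) : ℤ) * n : ℤ) : ℝ) := by push_cast; exact h2
      exact_mod_cast this
    exact h (Int.natCast_dvd_natCast.mp ⟨n, h3⟩)
  have key := two_sin_mul_sum_cos_odd β J
  have hzero : Real.sin (2 * J * β) = 0 := by
    have : 2 * J * β = m * Real.pi := by rw [hβ]; field_simp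
    rw [this, Real.sin_nat_mul_pi]
  rw [hzero] at key
  have hsum := (mul_eq_zero.mp key).resolve_left (mul_ne_zero two_ne_zero hsin)
  rw [← hsum]
  refine Finset.sum_congr rfl fun j _ => ?_
  congr 1
  rw [hβ, thetaNode]
  ring

theorem sum_cos_thetaNode_of_mul {J : ℕ} (hJ : J ≠ 0) (q : ℕ) :
    ∑ j ∈ Finset.range J, Real.cos ((2 * J * q : ℕ) * thetaNode J j) = J * (-1) ^ q := by
  have hJ' : (J : ℝ) ≠ 0 := by exact_mod_cast hJ
  rw [Finset.sum_congr rfl (g := fun _ => (-1 : ℝ) ^ q), Finset.sum_const, Finset.card_range,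
    nsmul_eq_mul]
  intro j _
  have : ((2 * J * q : ℕ) : ℝ) * thetaNode J j = ((q * (2 * j + 1) : ℕ) : ℝ) * Real.pi := by
    rw [thetaNode]
    push_cast
    field_simp
  rw [this, Real.cos_nat_mul_pi, mul_comm q, pow_mul, Odd.neg_one_pow ⟨j, rfl⟩]

theorem sum_kernel_add_two (J k : ℕ) :
    ∑ j ∈ Finset.range J, Real.sin ((k + 2 : ℕ) * thetaNode J j) / Real.sin (thetaNode J j) =
      ∑ j ∈ Finset.range J, Real.sin (k * thetaNode J j) / Real.sin (thetaNode J j) +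
        2 * ∑ j ∈ Finset.range J, Real.cos ((k + 1 : ℕ) * thetaNode J j) := by
  rw [Finset.mul_sum, ← Finset.sum_add_distrib]
  refine Finset.sum_congr rfl fun j hj => ?_
  exact sin_div_sin_add_two k (sin_thetaNode_pos (Finset.mem_range.mp hj)).ne'

theorem sum_kernel_even {J : ℕ} (hJ : J ≠ 0) (n : ℕ) :
    ∑ j ∈ Finset.range J, Real.sin ((2 * n : ℕ) * thetaNode J j) / Real.sin (thetaNode J j)
      = 0 := by
  induction n with
  | zero => simp
  | succ n ih =>
    rw [show 2 * (n + 1) = 2 * n + 2 by ring, sum_kernel_add_two, ih,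
      sum_cos_thetaNode_of_not_dvd hJ, mul_zero, add_zero]
    -- The cosine frequency `2n+1` is odd, so `2J` never divides it.
    rintro ⟨c, hc⟩
    have : 2 * n + 1 = 2 * (J * c) := by rw [hc]; ring
    omega

theorem sum_kernel_odd {J : ℕ} (hJ : J ≠ 0) (n : ℕ) :
    ∑ j ∈ Finset.range J, Real.sin ((2 * n + 1 : ℕ) * thetaNode J j) / Real.sin (thetaNode J j)
      = J * (-1) ^ (n / J) := by
  induction n with
  | zero =>
    rw [Nat.zero_div, pow_zero, mul_one, Finset.sum_congr rfl (g := fun _ => (1 : ℝ))]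
    · simp
    · intro j hj
      simpa using div_self (sin_thetaNode_pos (Finset.mem_range.mp hj)).ne'
  | succ n ih =>
    rw [show 2 * (n + 1) + 1 = 2 * n + 1 + 2 by ring, sum_kernel_add_two, ih, Nat.succ_div]
    -- The cosine frequency is `2(n+1)`. Only when it equals `2Jq` is there a contribution,
    -- `2J(-1)^q`, which flips `J(-1)^(q-1)` into `J(-1)^q`.
    by_cases hd : J ∣ n + 1
    · obtain ⟨q, hq⟩ := hd
      have h1 : n / J + 1 = q := by
        have := Nat.succ_div (a := n) (b := J)
        rw [if_pos ⟨q, hq⟩, hq, Nat.mul_div_cancel_left _ (Nat.pos_of_ne_zero hJ)] at this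
        exact this.symm
      rw [if_pos ⟨q, hq⟩, h1, show 2 * n + 1 + 1 = 2 * J * q by rw [mul_assoc, ← hq]; ring,
        sum_cos_thetaNode_of_mul hJ, ← h1, pow_succ]
      ring
    · rw [if_neg hd, sum_cos_thetaNode_of_not_dvd hJ, mul_zero, add_zero, add_zero]
      rintro ⟨c, hc⟩
      refine hd ⟨c, ?_⟩
      have : 2 * (n + 1) = 2 * (J * c) := by rw [← mul_assoc, ← hc]; ring
      omega

/-- The discrete average of the kernel expressed by the signed odd series. -/
theorem kernelAverage_eq {s : ℂ} (hs : 1 < s.re) {J : ℕ} (hJ : J ≠ 0) :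
    kernelAverage s J = (I / 2 * ((2 * Real.pi * I) ^ s / Gamma (s + 1)))⁻¹ * xi s J := by
  set c := (I / 2 * ((2 * Real.pi * I) ^ s / Gamma (s + 1)))⁻¹
  have hJ' : (J : ℝ) ≠ 0 := by exact_mod_cast hJ
  have hJc : (J : ℂ) ≠ 0 := by exact_mod_cast hJ
  set D : ℕ → ℝ := fun k =>
    ∑ j ∈ Finset.range J, Real.sin (k * thetaNode J j) / Real.sin (thetaNode J j) with hD
  have hangle : ∀ j : ℕ, 2 * Real.pi * ((2 * j + 1) / (4 * J)) = thetaNode J j := by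
    intro j
    rw [thetaNode]
    field_simp
    ring
  have hsm : ∀ j : ℕ, Summable fun k : ℕ => 1 / (k : ℂ) ^ s *
      ((Real.sin (k * thetaNode J j) / Real.sin (thetaNode J j) : ℝ) : ℂ) := by
    intro j
    have h := (summable_sineSeries hs ((2 * j + 1) / (4 * J))).div_const
      (Real.sin (thetaNode J j) : ℂ)
    simp only [hangle] at h
    refine h.congr fun k => ?_
    push_cast
    ring
  have hterm : ∀ j : ℕ, bernoulliFn s ((2 * j + 1) / (4 * J)) / (Real.sin (thetaNode J j) : ℂ) =
      c * ∑' k : ℕ, 1 / (k : ℂ) ^ s *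
        ((Real.sin (k * thetaNode J j) / Real.sin (thetaNode J j) : ℝ) : ℂ) := by
    intro j
    rw [bernoulliFn_eq_sineSeries hs, mul_div_assoc, sineSeries, ← tsum_div_const]
    simp only [hangle]
    congr 1
    refine tsum_congr fun k => ?_
    push_cast
    ring
  have hswap : ∑ j ∈ Finset.range J, ∑' k : ℕ, 1 / (k : ℂ) ^ s *
      ((Real.sin (k * thetaNode J j) / Real.sin (thetaNode J j) : ℝ) : ℂ) =
      ∑' k : ℕ, 1 / (k : ℂ) ^ s * (D k : ℂ) := by
    rw [← Summable.tsum_finsetSum fun j _ => hsm j]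
    refine tsum_congr fun k => ?_
    rw [hD, ofReal_sum, Finset.mul_sum]
  have hDsum : Summable fun k : ℕ => 1 / (k : ℂ) ^ s * (D k : ℂ) := by
    refine (summable_sum (s := Finset.range J) fun j _ => hsm j).congr fun k => ?_
    rw [hD, ofReal_sum, Finset.mul_sum]
  have hodd : ∑' k : ℕ, 1 / (k : ℂ) ^ s * (D k : ℂ) = J * xi s J := by
    rw [← tsum_even_add_odd (f := fun k : ℕ => 1 / (k : ℂ) ^ s * (D k : ℂ))
      (hDsum.comp_injective (i := fun n : ℕ => 2 * n) fun a b h => by simpa using h)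
      (hDsum.comp_injective (i := fun n : ℕ => 2 * n + 1) fun a b h => by simpa using h),
      (signed_odd_blocks hs J hJ).2, ← tsum_mul_left]
    have h0 : ∀ n : ℕ, 1 / ((2 * n : ℕ) : ℂ) ^ s * (D (2 * n) : ℂ) = 0 := fun n => by
      rw [show D (2 * n) = 0 from sum_kernel_even hJ n, ofReal_zero, mul_zero]
    rw [tsum_congr h0, tsum_zero, zero_add]
    refine tsum_congr fun n => ?_
    rw [show D (2 * n + 1) = J * (-1) ^ (n / J) from sum_kernel_odd hJ n]
    push_cast
    ring
  rw [kernelAverage, Finset.sum_congr rfl fun j _ => hterm j, ← Finset.mul_sum, hswap, hodd]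
  field_simp

/-! ### The integral of the kernel -/

/-- Take `p` to be a zero of the sine within `1/4` of `x`: Jordan's inequality then gives even `4|x
- p|` as a lower bound. -/
theorem exists_abs_sub_le_abs_sin {x : ℝ} (hx : x ∈ Set.Ioo (0 : ℝ) 1) :
    ∃ p ∈ ({0, 1 / 2, 1} : Set ℝ), |x - p| ≤ |Real.sin (2 * Real.pi * x)| := by
  have hnear : ∀ n : ℕ, |x - n / 2| ≤ 1 / 4 →
      |x - n / 2| ≤ |Real.sin (2 * Real.pi * x)| := by
    intro n hn
    have h1 : |2 * Real.pi * (x - n / 2)| = 2 * Real.pi * |x - n / 2| := by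
      rw [abs_mul, abs_of_pos (by positivity)]
    have h2 := Real.mul_abs_le_abs_sin (x := 2 * Real.pi * (x - n / 2)) (by
      rw [h1]
      nlinarith [Real.pi_pos])
    have h3 : 2 * Real.pi * x = 2 * Real.pi * (x - n / 2) + n * Real.pi := by ring
    have h4 : |Real.sin (2 * Real.pi * x)| = |Real.sin (2 * Real.pi * (x - n / 2))| := by
      rw [h3, Real.sin_add_nat_mul_pi, abs_mul]
      simp
    rw [h4]
    refine le_trans ?_ h2
    rw [h1, show 2 / Real.pi * (2 * Real.pi * |x - n / 2|) = 4 * |x - n / 2| by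
      field_simp; ring]
    linarith [abs_nonneg (x - (n : ℝ) / 2)]
  rcases le_total x (1 / 4) with h | h
  · refine ⟨0, by simp, ?_⟩
    simpa using hnear 0 (by rw [abs_le]; constructor <;> push_cast <;> linarith [hx.1])
  rcases le_total x (3 / 4) with h' | h'
  · refine ⟨1 / 2, by simp, ?_⟩
    simpa using hnear 1 (by rw [abs_le]; constructor <;> push_cast <;> linarith)
  · refine ⟨1, by simp, ?_⟩
    simpa using hnear 2 (by rw [abs_le]; constructor <;> push_cast <;> linarith [hx.2])

theorem integrableOn_abs_sub_rpow {r : ℝ} (hr : -1 < r) (p : ℝ) :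
    IntegrableOn (fun x : ℝ => |x - p| ^ r) (Set.Ioo 0 1) := by
  -- The complex power is used because its norm is `|y|^r` on both sides of the singularity.
  have h := ((intervalIntegral.intervalIntegrable_cpow' (a := 0 - p) (b := 1 - p) (r := (r : ℂ))
    (by simpa using hr)).norm).comp_sub_right p
  simp only [norm_cpow_real, norm_real, Real.norm_eq_abs, sub_add_cancel] at h
  exact (intervalIntegrable_iff_integrableOn_Ioo_of_le zero_le_one).mp h

theorem sin_two_pi_ne_zero {x : ℝ} (hx : x ∈ Set.Ioo (0 : ℝ) 1) (h : x ≠ 1 / 2) :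
    Real.sin (2 * Real.pi * x) ≠ 0 := by
  intro h0
  obtain ⟨p, hp, hle⟩ := exists_abs_sub_le_abs_sin hx
  rw [h0, abs_zero] at hle
  have hxp : x = p := sub_eq_zero.mp (abs_eq_zero.mp (le_antisymm hle (abs_nonneg _)))
  rcases hp with rfl | rfl | rfl
  · exact hx.1.ne' hxp
  · exact h hxp
  · exact hx.2.ne hxp

theorem ae_sin_two_pi_ne_zero :
    ∀ᵐ x : ℝ ∂(volume.restrict (Set.Ioo 0 1)), Real.sin (2 * Real.pi * x) ≠ 0 := by
  rw [ae_restrict_iff' measurableSet_Ioo]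
  filter_upwards [Measure.ae_ne volume (1 / 2 : ℝ)] with x hx hmem
  exact sin_two_pi_ne_zero hmem hx

theorem integrableOn_abs_sin_rpow {r : ℝ} (hr : -1 < r) (hr0 : r ≤ 0) :
    IntegrableOn (fun x : ℝ => |Real.sin (2 * Real.pi * x)| ^ r) (Set.Ioo 0 1) := by
  -- As `r ≤ 0`, the distance bound reverses under the power; summing over all three zeros avoids
  -- tracking which one is near.
  have hint := ((integrableOn_abs_sub_rpow hr 0).add (integrableOn_abs_sub_rpow hr (1 / 2))).add
    (integrableOn_abs_sub_rpow hr 1)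
  refine Integrable.mono' hint (Measurable.aestronglyMeasurable (by fun_prop)) ?_
  rw [ae_restrict_iff' measurableSet_Ioo]
  filter_upwards [Measure.ae_ne volume (1 / 2 : ℝ)] with x hx hmem
  obtain ⟨p, hp, hle⟩ := exists_abs_sub_le_abs_sin hmem
  have hxp : x ≠ p := by
    rcases hp with rfl | rfl | rfl
    exacts [hmem.1.ne', hx, hmem.2.ne]
  have h1 := Real.rpow_le_rpow_of_nonpos (abs_pos.mpr (sub_ne_zero.mpr hxp)) hle hr0
  rw [Real.norm_of_nonneg (by positivity)]
  refine h1.trans ?_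
  have e0 : 0 ≤ |x - 0| ^ r := by positivity
  have e1 : 0 ≤ |x - 1 / 2| ^ r := by positivity
  have e2 : 0 ≤ |x - 1| ^ r := by positivity
  simp only [Pi.add_apply]
  rcases hp with rfl | rfl | rfl <;> linarith

theorem integrableOn_kernel (k : ℕ) :
    IntegrableOn (fun x : ℝ => Real.sin (k * (2 * Real.pi * x)) / Real.sin (2 * Real.pi * x))
      (Set.Ioo 0 1) := by
  refine Integrable.mono' ((integrableOn_abs_sin_rpow (r := 1 / 2 - 1) (by norm_num)
    (by norm_num)).const_mul ((k : ℝ) ^ (1 / 2 : ℝ))) (Measurable.aestronglyMeasurable (by fun_prop))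
    (Eventually.of_forall fun x => ?_)
  exact abs_sin_div_sin_le k _ (by norm_num) (by norm_num)

theorem integral_cos_two_pi (k : ℕ) (hk : k ≠ 0) :
    ∫ x in Set.Ioo (0 : ℝ) 1, Real.cos (k * (2 * Real.pi * x)) = 0 := by
  have hk' : (k : ℝ) * (2 * Real.pi) ≠ 0 := by
    have : (k : ℝ) ≠ 0 := by exact_mod_cast hk
    positivity
  rw [← integral_Ioc_eq_integral_Ioo, ← intervalIntegral.integral_of_le zero_le_one]
  simp only [← mul_assoc]
  rw [← mul_assoc] at hk'
  rw [intervalIntegral.integral_comp_mul_left (fun y => Real.cos y) hk', integral_cos]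
  have : (k : ℝ) * 2 * Real.pi * 1 = ((k * 2 : ℕ) : ℝ) * Real.pi := by push_cast; ring
  rw [this, Real.sin_nat_mul_pi]
  simp

theorem integral_kernel_add_two (k : ℕ) :
    ∫ x in Set.Ioo (0 : ℝ) 1,
        Real.sin ((k + 2 : ℕ) * (2 * Real.pi * x)) / Real.sin (2 * Real.pi * x) =
      ∫ x in Set.Ioo (0 : ℝ) 1, Real.sin (k * (2 * Real.pi * x)) / Real.sin (2 * Real.pi * x) := by
  have hcos : IntegrableOn (fun x : ℝ => 2 * Real.cos ((k + 1 : ℕ) * (2 * Real.pi * x)))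
      (Set.Ioo 0 1) :=
    (Continuous.integrableOn_Icc (by fun_prop)).mono_set Set.Ioo_subset_Icc_self
  rw [integral_congr_ae (ae_sin_two_pi_ne_zero.mono fun x hx => sin_div_sin_add_two k hx),
    integral_add (integrableOn_kernel k) hcos, integral_const_mul,
    integral_cos_two_pi _ (Nat.succ_ne_zero k), mul_zero, add_zero]

theorem integral_kernel_even (n : ℕ) : ∫ x in Set.Ioo (0 : ℝ) 1,
    Real.sin ((2 * n : ℕ) * (2 * Real.pi * x)) / Real.sin (2 * Real.pi * x) = 0 := by
  induction n with
  | zero => simp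
  | succ n ih => rw [show 2 * (n + 1) = 2 * n + 2 by ring, integral_kernel_add_two, ih]

theorem integral_kernel_odd (n : ℕ) : ∫ x in Set.Ioo (0 : ℝ) 1,
    Real.sin ((2 * n + 1 : ℕ) * (2 * Real.pi * x)) / Real.sin (2 * Real.pi * x) = 1 := by
  induction n with
  | zero =>
    rw [integral_congr_ae (g := fun _ => (1 : ℝ))
      (ae_sin_two_pi_ne_zero.mono fun x hx => by simpa using div_self hx)]
    simp
  | succ n ih => rw [show 2 * (n + 1) + 1 = 2 * n + 1 + 2 by ring, integral_kernel_add_two, ih]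

/-! ### The principal value -/

theorem sineSeries_div_sin (s : ℂ) (x : ℝ) :
    sineSeries s x / (Real.sin (2 * Real.pi * x) : ℂ) = ∑' k : ℕ, 1 / (k : ℂ) ^ s *
      ((Real.sin (k * (2 * Real.pi * x)) / Real.sin (2 * Real.pi * x) : ℝ) : ℂ) := by
  rw [sineSeries, ← tsum_div_const]
  refine tsum_congr fun k => ?_
  push_cast
  ring

/-- The bound separates `k` from `x`, so one estimate serves both the summation and the integration.
-/
theorem norm_kernel_term_le {s : ℂ} (hs : 1 < s.re) {a : ℝ} (ha : 0 < a) (ha1 : a < 1)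
    (k : ℕ) (x : ℝ) :
    ‖1 / (k : ℂ) ^ s *
        ((Real.sin (k * (2 * Real.pi * x)) / Real.sin (2 * Real.pi * x) : ℝ) : ℂ)‖ ≤
      1 / (k : ℝ) ^ (s.re - a) * |Real.sin (2 * Real.pi * x)| ^ (a - 1) := by
  rw [norm_mul, norm_one_div_natCast_cpow (by linarith), norm_real, Real.norm_eq_abs]
  rcases Nat.eq_zero_or_pos k with rfl | hk
  · simp only [Nat.cast_zero, zero_mul, Real.sin_zero, zero_div, abs_zero, mul_zero]
    positivity
  have hk' : (0 : ℝ) < k := by exact_mod_cast hk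
  refine (mul_le_mul_of_nonneg_left (abs_sin_div_sin_le k _ ha ha1) (by positivity)).trans_eq ?_
  rw [← mul_assoc, Real.rpow_sub hk']
  field_simp

/-- `1 < σ - a` makes the sum over `k` converge, and `0 < a` makes `|sin|^(a-1)` integrable. -/
theorem exists_interpolation_exponent {σ : ℝ} (h : 1 < σ) : ∃ a : ℝ, 0 < a ∧ a < 1 ∧ 1 < σ - a :=
  ⟨min (1 / 2) ((σ - 1) / 2), lt_min (by norm_num) (by linarith), by
    exact (min_le_left _ _).trans_lt (by norm_num), by
    linarith [min_le_right (1 / 2) ((σ - 1) / 2)]⟩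

theorem integrableOn_sineSeries_div_sin {s : ℂ} (hs : 1 < s.re) :
    IntegrableOn (fun x : ℝ => sineSeries s x / (Real.sin (2 * Real.pi * x) : ℂ))
      (Set.Ioo 0 1) := by
  obtain ⟨a, ha, ha1, hsa⟩ := exists_interpolation_exponent hs
  have hsum : Summable fun k : ℕ => 1 / (k : ℝ) ^ (s.re - a) :=
    Real.summable_one_div_nat_rpow.mpr hsa
  refine Integrable.mono' ((integrableOn_abs_sin_rpow (r := a - 1) (by linarith)
    (by linarith)).const_mul (∑' k : ℕ, 1 / (k : ℝ) ^ (s.re - a))) ?_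
    (Eventually.of_forall fun x => ?_)
  · have h1 := (continuous_sineSeries hs).measurable
    exact Measurable.aestronglyMeasurable (h1.div (by fun_prop))
  · rw [sineSeries_div_sin, ← tsum_mul_right]
    exact tsum_of_norm_bounded (hsum.mul_right _).hasSum
      fun k => norm_kernel_term_le hs ha ha1 k x

theorem integral_sineSeries_div_sin {s : ℂ} (hs : 1 < s.re) :
    ∫ x in Set.Ioo (0 : ℝ) 1, sineSeries s x / (Real.sin (2 * Real.pi * x) : ℂ) =
      (1 - 2 ^ (-s)) * riemannZeta s := by
  obtain ⟨a, ha, ha1, hsa⟩ := exists_interpolation_exponent hs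
  have hsin := integrableOn_abs_sin_rpow (r := a - 1) (by linarith) (by linarith)
  have hF : ∀ k : ℕ, IntegrableOn (fun x : ℝ => 1 / (k : ℂ) ^ s *
      ((Real.sin (k * (2 * Real.pi * x)) / Real.sin (2 * Real.pi * x) : ℝ) : ℂ))
      (Set.Ioo 0 1) := fun k => (integrableOn_kernel k).ofReal.const_mul _
  have hnorm : Summable fun k : ℕ => ∫ x in Set.Ioo (0 : ℝ) 1, ‖1 / (k : ℂ) ^ s *
      ((Real.sin (k * (2 * Real.pi * x)) / Real.sin (2 * Real.pi * x) : ℝ) : ℂ)‖ := by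
    refine Summable.of_nonneg_of_le (fun k => integral_nonneg fun x => norm_nonneg _) (fun k => ?_)
      ((Real.summable_one_div_nat_rpow.mpr hsa).mul_right
        (∫ x in Set.Ioo (0 : ℝ) 1, |Real.sin (2 * Real.pi * x)| ^ (a - 1)))
    rw [← integral_const_mul]
    exact integral_mono (hF k).norm (hsin.const_mul _) fun x => norm_kernel_term_le hs ha ha1 k x
  -- Summability of the `L¹` norms permits termwise integration; parity then selects the odd series.
  have hsum := hasSum_integral_of_summable_integral_norm hF hnorm
  simp only [integral_const_mul, integral_complex_ofReal, ← sineSeries_div_sin] at hsum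
  refine hsum.unique ?_
  rw [← zero_add ((1 - 2 ^ (-s)) * riemannZeta s)]
  refine HasSum.even_add_odd ?_ ?_
  · simp only [integral_kernel_even, ofReal_zero, mul_zero]
    exact hasSum_zero
  · simp only [integral_kernel_odd, ofReal_one, mul_one]
    exact hasSum_one_div_odd_cpow hs

theorem measurableSet_cutInterval (a b : ℝ) {S : Set ℝ} (hS : S.Finite) (ε : ℝ) :
    MeasurableSet (cutInterval a b S ε) := by
  have : cutInterval a b S ε = Set.Ioo a b ∩ ⋂ p ∈ S, {x : ℝ | ε < |x - p|} := by
    ext x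
    simp [cutInterval]
  rw [this]
  refine measurableSet_Ioo.inter (MeasurableSet.biInter hS.countable fun p _ => ?_)
  exact measurableSet_lt measurable_const (by fun_prop)

/-- An integrable function has its integral as principal value. -/
theorem hasPrincipalValue_of_integrableOn {f : ℝ → ℂ} {a b : ℝ} {S : Set ℝ} (hS : S.Finite)
    (hf : IntegrableOn f (Set.Ioo a b)) :
    HasPrincipalValue f a b S (∫ x in Set.Ioo a b, f x) := by
  have hsub : ∀ ε, cutInterval a b S ε ⊆ Set.Ioo a b := fun ε x hx => hx.1
  refine ⟨fun ε _ => hf.mono_set (hsub ε), ?_⟩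
  have heq : ∀ ε, ∫ x in cutInterval a b S ε, f x =
      ∫ x in Set.Ioo a b, (cutInterval a b S ε).indicator f x := fun ε => by
    rw [setIntegral_indicator (measurableSet_cutInterval a b hS ε),
      Set.inter_eq_right.mpr (hsub ε)]
  simp only [heq]
  refine tendsto_integral_filter_of_dominated_convergence (fun x => ‖f x‖)
    (Eventually.of_forall fun ε =>
      hf.aestronglyMeasurable.indicator (measurableSet_cutInterval a b hS ε))
    (Eventually.of_forall fun ε => Eventually.of_forall fun x => norm_indicator_le_norm_self f x)
    hf.norm ?_
  rw [ae_restrict_iff' measurableSet_Ioo]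
  filter_upwards [hS.countable.ae_notMem volume] with x hx hmem
  refine tendsto_const_nhds.congr' ?_
  -- Off the finite set `S`, a point lies in every cut interval with `ε` small enough, so the
  -- indicators converge almost everywhere.
  have hev : ∀ᶠ ε in 𝓝[>] (0 : ℝ), ∀ p ∈ S, ε < |x - p| := by
    rw [hS.eventually_all]
    intro p hp
    have hpos : 0 < |x - p| := abs_pos.mpr (sub_ne_zero.mpr fun h => hx (h ▸ hp))
    exact mem_nhdsWithin_of_mem_nhds (Iio_mem_nhds hpos)
  filter_upwards [hev] with ε hε
  rw [Set.indicator_of_mem (show x ∈ cutInterval a b S ε from ⟨hmem, hε⟩)]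

theorem mainTheorem2 (s : ℂ) (hs : 1 < s.re) :
    (∀ J : ℕ, Summable fun m : ℕ => (-1 : ℂ) ^ m * xiBlock s J m) ∧
    Tendsto (fun J : ℕ => xi s J) atTop (𝓝 (∑' m : ℕ, 1 / ((2 * m + 1 : ℕ) : ℂ) ^ s)) ∧
    HasSum (fun m : ℕ => 1 / ((2 * m + 1 : ℕ) : ℂ) ^ s) ((1 - 2 ^ (-s)) * riemannZeta s) ∧
    ∃ P : ℂ,
      HasPrincipalValue (fun x : ℝ => bernoulliFn s x / (Real.sin (2 * Real.pi * x) : ℂ))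
        0 1 {0, 1 / 2, 1} P ∧
      Tendsto (fun J : ℕ => kernelAverage s J) atTop (𝓝 P) ∧
      (1 - 2 ^ (-s)) * riemannZeta s =
        I / 2 * ((2 * Real.pi * I) ^ s / Gamma (s + 1)) * P := by
  have hfun : (fun x : ℝ => bernoulliFn s x / (Real.sin (2 * Real.pi * x) : ℂ)) =
      fun x : ℝ => (I / 2 * ((2 * Real.pi * I) ^ s / Gamma (s + 1)))⁻¹ *
        (sineSeries s x / (Real.sin (2 * Real.pi * x) : ℂ)) := by
    funext x
    rw [bernoulliFn_eq_sineSeries hs, mul_div_assoc]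
  have hG : Gamma (s + 1) ≠ 0 := Gamma_ne_zero_of_re_pos (by simp; linarith)
  have hpow : (2 * Real.pi * I : ℂ) ^ s ≠ 0 := by
    rw [Ne, cpow_eq_zero_iff]
    exact fun h => two_pi_I_ne_zero h.1
  have hc : I / 2 * ((2 * Real.pi * I) ^ s / Gamma (s + 1)) ≠ 0 :=
    mul_ne_zero (div_ne_zero I_ne_zero two_ne_zero) (div_ne_zero hpow hG)
  refine ⟨summable_xiBlock hs, tendsto_xi hs, hasSum_one_div_odd_cpow hs,
    (I / 2 * ((2 * Real.pi * I) ^ s / Gamma (s + 1)))⁻¹ *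
      ((1 - 2 ^ (-s)) * riemannZeta s), ?_, ?_, ?_⟩
  · rw [hfun, ← integral_sineSeries_div_sin hs, ← integral_const_mul]
    exact hasPrincipalValue_of_integrableOn (by simp)
      ((integrableOn_sineSeries_div_sin hs).const_mul _)
  · have h := (tendsto_xi hs).const_mul (I / 2 * ((2 * Real.pi * I) ^ s / Gamma (s + 1)))⁻¹
    rw [(hasSum_one_div_odd_cpow hs).tsum_eq] at h
    refine h.congr' ?_
    filter_upwards [eventually_ne_atTop 0] with J hJ
    exact (kernelAverage_eq hs hJ).symm
  · rw [mul_inv_cancel_left₀ hc]
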